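/- Let $d\ge 1$, $\beta_0\in\mathbb R^d$, $s_0>0$, and let $(X_1,Y_1),(X_2,Y_2),\dots$ be i.i.d. copies of a pair $(X,Y)\in\mathbb R^d\times\mathbb R$ with $Y=\beta_0^TX+\epsilon$. Write $\log 0=-\infty$, and assume: (A1) $X$ and $\epsilon$ are independent. (A2) The distribution of $X$ has a density with respect to Lebesgue measure on $\mathbb R^d$. (A3) $\epsilon$ has the density $t\mapsto s_0^{-1}f(t/s_0)$, where $f$ is an even, bounded and continuous probability density on $\mathbb R$ with $\int t^2f(t)\,dt<\infty$. (A4) There are $\alpha>0$ and $C>0$ such that $f(t)\le C\exp(-|t|^\alpha)$ for all $t\in\mathbb R$. (A5) $\mathbb E\left|\log f\left(\frac{Y-\beta_0^TX}{s_0}\right)\right|<\infty$. (A6) $\mathbb E\left[\|X\|^{\max(2\alpha,2)}\right]<\infty$, with $\alpha$ as in (A4). (A7) $f$ is non-increasing on $[0,\infty)$. (A8) $\mathbb E\left[\left(\log f\left(\frac{|Y|+R\|X\|}{a}\right)\right)^2\right]<\infty$ for all $R>0$ and $a>0$. For $(\beta,s)\in\mathbb R^d\times(0,\infty)$ let $$\ell_n(\beta,s)=-n\log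 s+\sum_{i=1}^n\log f\left(\frac{Y_i-\beta^TX_i}{s}\right).$$ Let $(\widehat\beta_n,\widehat s_n)$, $n\ge 1$, be any maximum likelihood estimators, that is, random vectors such that, for every $n$, almost surely, $(\widehat\beta_n,\widehat s_n)$ maximizes $\ell_n$ over $\mathbb R^d\times(0,\infty)$ whenever $\ell_n$ has a maximizer there (and is arbitrary otherwise). Then $(\widehat\beta_n,\widehat s_n)\to(\beta_0,s_0)$ in probability as $n\to\infty$. -/

import Mathlib

open MeasureTheory ProbabilityTheory Filter Topology
open scoped ENNReal

noncomputable section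

/-- The logarithm of a nonnegative real number with values in the extended reals, with
`extLog 0 = -∞` (unlike `Real.log 0 = 0`). -/
def extLog (u : ℝ) : EReal := ENNReal.log (ENNReal.ofReal u)

/-- The reference density: an even, bounded and continuous probability density on the real line
with a finite second moment. -/
structure IsReferenceDensity (f : ℝ → ℝ) : Prop where
  nonneg : ∀ t, 0 ≤ f t
  integrable : Integrable f
  integral_eq_one : ∫ t, f t = 1
  even : ∀ t, f (-t) = f t
  bounded : ∃ B, ∀ t, f t ≤ B
  continuous : Continuous f
  second_moment : Integrable (fun t => t ^ 2 * f t)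

/-- The member `t ↦ s⁻¹ f (t / s)` of the scale family generated by `f`. -/
def scaleDensity (f : ℝ → ℝ) (s t : ℝ) : ℝ := s⁻¹ * f (t / s)

/-- The (conditional) log-likelihood at `(β, s)` of the first `n` pairs `(x i, y i)`. -/
def logLik {d : ℕ} (f : ℝ → ℝ) (x : ℕ → EuclideanSpace ℝ (Fin d)) (y : ℕ → ℝ) (n : ℕ)
    (β : EuclideanSpace ℝ (Fin d)) (s : ℝ) : EReal :=
  ((-(n * Real.log s) : ℝ) : EReal)
    + ∑ i ∈ Finset.range n, extLog (f ((y i - inner ℝ β (x i)) / s))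

/-- `θ = (β, s)` maximizes the log-likelihood of the first `n` pairs over `ℝ^d × (0, ∞)`. -/
def IsMLE {d : ℕ} (f : ℝ → ℝ) (x : ℕ → EuclideanSpace ℝ (Fin d)) (y : ℕ → ℝ) (n : ℕ)
    (θ : EuclideanSpace ℝ (Fin d) × ℝ) : Prop :=
  0 < θ.2 ∧ ∀ (β : EuclideanSpace ℝ (Fin d)) (s : ℝ), 0 < s →
    logLik f x y n β s ≤ logLik f x y n θ.1 θ.2

end

/-! This is Wald's consistency argument, and it yields almost sure convergence. First, `f` is
strictly positive: if it vanished somewhere it would vanish from there on, and the envelope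
condition with ever smaller `a` would force `Y = 0` almost surely, which is impossible. Hence the
log-likelihood is a real-valued sum of terms `unitLogLik`.

The expectation of one term is uniquely maximal at the truth (`integral_unitLogLik_lt`): the gap is
a Kullback–Leibler divergence, and equality would identify location and scale. Near any other
parameter, all terms lie below a single integrable `localMajorant` whose mean is still below the
optimum. The strong law and a finite cover then dispose of every compact set of parameters that
avoids a neighbourhood of the truth.

The rest of the parameter space is handled by a slab count. The law of `(X, Y)` charges no
hyperplane through the origin, so by compactness of the unit sphere some `η` works for all
directions at once: for large `n` at most half of the observations are within `η` of any such
hyperplane (`exists_ae_eventually_slab_le`). The others have residual above `η * max ‖β‖ 1`, and the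
tail bound on `f` makes them pay a power of that residual over `s`. This beats `-log s` as `s → 0`;
together with `-log s` itself it also rules out large `s` and large `β`.

So eventually every parameter outside a small ball has smaller likelihood than the truth. A
maximizer then exists by compactness of the closed ball, and all maximizers lie in the ball. -/

/-- The contribution of the observation `z = (x, y)` to the log-likelihood at `θ = (β, s)`. -/
noncomputable def unitLogLik {d : ℕ} (f : ℝ → ℝ) (θ z : EuclideanSpace ℝ (Fin d) × ℝ) : ℝ :=
  -Real.log θ.2 + Real.log (f ((z.2 - inner ℝ θ.1 z.1) / θ.2))

/-- The linear form `(x, y) ↦ uᵀ x + v y` with coefficients `(u, v)`. -/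
noncomputable def pairForm {d : ℕ} (u z : EuclideanSpace ℝ (Fin d) × ℝ) : ℝ :=
  inner ℝ u.1 z.1 + u.2 * z.2

/-- An upper bound for the contributions `unitLogLik f θ' z` over all `θ'` within distance `ρ`
of `θ`, when `f` is even and decreasing on the half-line. -/
noncomputable def localMajorant {d : ℕ} (f : ℝ → ℝ) (θ : EuclideanSpace ℝ (Fin d) × ℝ) (ρ : ℝ)
    (z : EuclideanSpace ℝ (Fin d) × ℝ) : ℝ :=
  -Real.log (θ.2 - ρ) +
    Real.log (f (max (|z.2 - inner ℝ θ.1 z.1| - ρ * ‖z.1‖) 0 / (θ.2 + ρ)))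

/-! ### Bounds on the likelihood of a fixed sample. -/

section Deterministic

variable {d : ℕ} {f : ℝ → ℝ}

lemma extLog_of_pos {u : ℝ} (hu : 0 < u) : extLog u = (Real.log u : EReal) :=
  ENNReal.log_ofReal_of_pos hu

lemma logLik_eq_coe_sum (hpos : ∀ t, 0 < f t) (x : ℕ → EuclideanSpace ℝ (Fin d)) (y : ℕ → ℝ)
    (n : ℕ) (β : EuclideanSpace ℝ (Fin d)) (s : ℝ) :
    logLik f x y n β s = ((∑ i ∈ Finset.range n, unitLogLik f (β, s) (x i, y i) : ℝ) : EReal) := by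
  have h : ∀ m : ℕ, ∑ i ∈ Finset.range m, extLog (f ((y i - inner ℝ β (x i)) / s))
      = ((∑ i ∈ Finset.range m, Real.log (f ((y i - inner ℝ β (x i)) / s)) : ℝ) : EReal) := by
    intro m
    induction m with
    | zero => simp
    | succ m ih =>
      rw [Finset.sum_range_succ, Finset.sum_range_succ, ih, extLog_of_pos (hpos _), EReal.coe_add]
  rw [logLik, h, ← EReal.coe_add]
  simp [unitLogLik, Finset.sum_add_distrib]

lemma IsReferenceDensity.apply_abs (hf : IsReferenceDensity f) (t : ℝ) : f |t| = f t := by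
  rcases abs_choice t with h | h <;> rw [h]
  exact hf.even t

lemma IsReferenceDensity.le_of_abs_le (hf : IsReferenceDensity f)
    (hmono : AntitoneOn f (Set.Ici 0)) {a b : ℝ} (h : |b| ≤ |a|) : f a ≤ f b := by
  rw [← hf.apply_abs a, ← hf.apply_abs b]
  exact hmono (abs_nonneg b) (abs_nonneg a) h

lemma IsReferenceDensity.log_le_of_abs_le (hf : IsReferenceDensity f)
    (hmono : AntitoneOn f (Set.Ici 0)) (hpos : ∀ t, 0 < f t) {a b : ℝ} (h : |b| ≤ |a|) :
    Real.log (f a) ≤ Real.log (f b) :=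
  Real.log_le_log (hpos a) (hf.le_of_abs_le hmono h)

lemma measurable_pairForm (u : EuclideanSpace ℝ (Fin d) × ℝ) : Measurable (pairForm u) := by
  unfold pairForm; fun_prop

lemma measurable_unitLogLik (hf : Measurable f) (θ : EuclideanSpace ℝ (Fin d) × ℝ) :
    Measurable (unitLogLik f θ) := by
  unfold unitLogLik; fun_prop

lemma measurable_localMajorant (hf : Measurable f) (θ : EuclideanSpace ℝ (Fin d) × ℝ) (ρ : ℝ) :
    Measurable (localMajorant f θ ρ) := by
  unfold localMajorant; fun_prop

lemma pairForm_smul (c : ℝ) (u z : EuclideanSpace ℝ (Fin d) × ℝ) :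
    pairForm (c • u) z = c * pairForm u z := by
  simp only [pairForm, Prod.smul_fst, Prod.smul_snd, smul_eq_mul, real_inner_smul_left]; ring

/-- Lipschitz dependence on the coefficients, by which one slab controls those of all nearby
directions. The distance is that of the sup norm on the product. -/
lemma abs_pairForm_sub_le (u v z : EuclideanSpace ℝ (Fin d) × ℝ) :
    |pairForm u z - pairForm v z| ≤ dist u v * (‖z.1‖ + |z.2|) := by
  have h : pairForm u z - pairForm v z = inner ℝ (u.1 - v.1) z.1 + (u.2 - v.2) * z.2 := by
    simp only [pairForm, inner_sub_left]; ring
  rw [h, mul_add, dist_eq_norm]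
  refine (abs_add_le _ _).trans (add_le_add ((abs_real_inner_le_norm _ _).trans ?_) ?_)
  · exact mul_le_mul_of_nonneg_right (norm_fst_le (u - v)) (norm_nonneg _)
  · rw [abs_mul]
    exact mul_le_mul_of_nonneg_right (norm_snd_le (u - v)) (abs_nonneg _)

/-- Moving `β` by at most `ρ` shrinks the absolute residual by at most `ρ * ‖x‖`. The two
occurrences of the scale are bounded separately, by `θ.2 - ρ` in the logarithm and by `θ.2 + ρ` in
the argument of `f`. -/
lemma unitLogLik_le_localMajorant (hf : IsReferenceDensity f)
    (hmono : AntitoneOn f (Set.Ici 0)) (hpos : ∀ t, 0 < f t)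
    {θ θ' : EuclideanSpace ℝ (Fin d) × ℝ} {ρ : ℝ} (hρ : ρ < θ.2) (h : dist θ' θ ≤ ρ)
    (z : EuclideanSpace ℝ (Fin d) × ℝ) :
    unitLogLik f θ' z ≤ localMajorant f θ ρ z := by
  have h1 : ‖θ'.1 - θ.1‖ ≤ ρ := by
    rw [dist_eq_norm] at h; exact (norm_fst_le (θ' - θ)).trans h
  have h2 : |θ'.2 - θ.2| ≤ ρ := by
    rw [dist_eq_norm] at h; exact (norm_snd_le (θ' - θ)).trans h
  obtain ⟨h3, h4⟩ := abs_le.1 h2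
  have hs : 0 < θ'.2 := by linarith
  refine add_le_add (neg_le_neg (Real.log_le_log (by linarith) (by linarith))) ?_
  apply hf.log_le_of_abs_le hmono hpos
  rw [abs_div, abs_div, abs_of_nonneg (le_max_right _ _), abs_of_pos hs,
    abs_of_pos (by linarith : 0 < θ.2 + ρ)]
  refine div_le_div₀ (abs_nonneg _) (max_le ?_ (abs_nonneg _)) hs (by linarith)
  have h5 : z.2 - inner ℝ θ.1 z.1 = (z.2 - inner ℝ θ'.1 z.1) + inner ℝ (θ'.1 - θ.1) z.1 := by
    rw [inner_sub_left]; ring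
  rw [h5]
  have h6 := abs_add_le (z.2 - inner ℝ θ'.1 z.1) (inner ℝ (θ'.1 - θ.1) z.1)
  have h7 : |inner ℝ (θ'.1 - θ.1) z.1| ≤ ρ * ‖z.1‖ :=
    (abs_real_inner_le_norm _ _).trans (mul_le_mul_of_nonneg_right h1 (norm_nonneg _))
  linarith

/-- Coercivity of the envelope `-log s + K - (η w / s) ^ α / 2` in `(w, s)`. -/
lemma exists_envelope_lt {α η : ℝ} (hα : 0 < α) (hη : 0 < η) (K T : ℝ) :
    ∃ δ > 0, ∃ S R : ℝ, ∀ s > 0, ∀ w ≥ 1, (s < δ ∨ S < s ∨ R < w) →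
      -Real.log s + K - (η * w / s) ^ α / 2 < T := by
  -- This is `log x ≤ x - 1` at `x = (α / 4) * v ^ α`.
  obtain ⟨A, hA⟩ : ∃ A : ℝ, ∀ v > 0, Real.log v ≤ v ^ α / 4 + A := by
    refine ⟨(-1 - Real.log (α / 4)) / α, fun v hv => ?_⟩
    have h := Real.log_le_sub_one_of_pos (show 0 < α / 4 * v ^ α by positivity)
    rw [Real.log_mul (by positivity) (by positivity), Real.log_rpow hv] at h
    have h2 : v ^ α / 4 + (-1 - Real.log (α / 4)) / α
      = (α / 4 * v ^ α - 1 - Real.log (α / 4)) / α := by field_simp; ring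
    rw [h2, le_div_iff₀ hα]
    linarith
  -- Half of the penalty is spent on `-log s = log (η w / s) - log η - log w`. The resulting `-log
  -- w` is uniform in `s`; the remaining quarter power handles small `s`.
  have key : ∀ s > 0, ∀ w ≥ 1, -Real.log s + K - (η * w / s) ^ α / 2
      ≤ K + A - Real.log η - Real.log w - (η * w / s) ^ α / 4 := by
    intro s hs w hw
    have hw0 : 0 < w := by linarith
    have h := hA (η * w / s) (by positivity)
    rw [Real.log_div (by positivity) hs.ne', Real.log_mul hη.ne' hw0.ne'] at h
    linarith
  -- `B` is a penalty large enough to push the bound in `key` below `T`; since `w ≥ 1`, the choice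
  -- of `δ` ensures a penalty of at least `B` whenever `s < δ`. For large `s` the penalty is simply
  -- dropped.
  set B : ℝ := max 1 (4 * (K + A - Real.log η - T) + 1) with hB
  have hB1 : 0 < B := lt_of_lt_of_le one_pos (le_max_left _ _)
  have hBp : 0 < B ^ (1 / α) := Real.rpow_pos_of_pos hB1 _
  refine ⟨η / B ^ (1 / α), by positivity, Real.exp (K - T), Real.exp (K + A - Real.log η - T),
    fun s hs w hw h => ?_⟩
  have hw0 : 0 < w := by linarith
  have hlw : 0 ≤ Real.log w := Real.log_nonneg hw
  have hv : 0 ≤ (η * w / s) ^ α := by positivity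
  have hk := key s hs w hw
  rcases h with h | h | h
  · have h1 : B ≤ (η * w / s) ^ α := by
      have h2 : B ^ (1 / α) ≤ η * w / s := by
        rw [le_div_iff₀ hs]
        rw [lt_div_iff₀ hBp] at h
        nlinarith
      calc B = (B ^ (1 / α)) ^ α := by
            rw [← Real.rpow_mul hB1.le, one_div_mul_cancel hα.ne', Real.rpow_one]
        _ ≤ _ := Real.rpow_le_rpow hBp.le h2 hα.le
    have h3 := le_max_right 1 (4 * (K + A - Real.log η - T) + 1)
    linarith
  · have h1 : K - T < Real.log s := (Real.lt_log_iff_exp_lt hs).2 h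
    linarith
  · have h1 := (Real.lt_log_iff_exp_lt hw0).2 h
    linarith

/-- If at most half of the observations lie in the slab of half-width `η` around the
hyperplane with normalized coefficients `(-β, 1) / max ‖β‖ 1`, the log-likelihood is below
the coercive envelope. -/
lemma sum_unitLogLik_le (hf : IsReferenceDensity f) (hmono : AntitoneOn f (Set.Ici 0))
    (hpos : ∀ t, 0 < f t) {α C : ℝ} (hα : 0 < α) (hC : 0 < C)
    (htail : ∀ t, f t ≤ C * Real.exp (-(|t| ^ α))) {η : ℝ} (hη : 0 < η)
    (z : ℕ → EuclideanSpace ℝ (Fin d) × ℝ) (n : ℕ)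
    (hslab : ∀ u : EuclideanSpace ℝ (Fin d) × ℝ, ‖u‖ = 1 →
      ∑ i ∈ Finset.range n, Set.indicator {z | |pairForm u z| ≤ η} (fun _ => (1 : ℝ)) (z i)
        ≤ n * (1 / 2))
    (θ : EuclideanSpace ℝ (Fin d) × ℝ) (hs : 0 < θ.2) :
    ∑ i ∈ Finset.range n, unitLogLik f θ (z i) ≤
      n * (-Real.log θ.2 + max (Real.log (f 0)) (Real.log C)
        - (η * max ‖θ.1‖ 1 / θ.2) ^ α / 2) := by
  set w := max ‖θ.1‖ 1
  have hw : 0 < w := lt_of_lt_of_le one_pos (le_max_right _ _)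
  set K := max (Real.log (f 0)) (Real.log C)
  set V := (η * w / θ.2) ^ α with hV
  have hV0 : 0 ≤ V := by positivity
  set u : EuclideanSpace ℝ (Fin d) × ℝ := w⁻¹ • (-θ.1, 1) with hu
  have hu1 : ‖u‖ = 1 := by
    rw [hu, norm_smul, Prod.norm_def]
    simp only [norm_neg, norm_one, norm_inv, Real.norm_eq_abs, abs_of_pos hw]
    exact inv_mul_cancel₀ hw.ne'
  set I : EuclideanSpace ℝ (Fin d) × ℝ → ℝ :=
    Set.indicator {z | |pairForm u z| ≤ η} (fun _ => (1 : ℝ)) with hI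
  -- Inside the slab only `f ≤ f 0` is available. Outside, the residual exceeds `η * w` and the tail
  -- bound gives the full penalty `V`.
  have hterm : ∀ z, unitLogLik f θ z ≤ (-Real.log θ.2 + K - V) + V * I z := by
    intro z
    have hz : pairForm u z = w⁻¹ * (z.2 - inner ℝ θ.1 z.1) := by
      rw [hu, pairForm_smul]; simp only [pairForm, inner_neg_left, one_mul]; ring
    by_cases h : |pairForm u z| ≤ η
    · have h1 : I z = 1 := Set.indicator_of_mem (s := {z | |pairForm u z| ≤ η}) h _
      have h2 : Real.log (f ((z.2 - inner ℝ θ.1 z.1) / θ.2)) ≤ Real.log (f 0) :=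
        hf.log_le_of_abs_le hmono hpos (by simp)
      have h3 : Real.log (f 0) ≤ K := le_max_left _ _
      rw [h1, unitLogLik]; linarith
    · have h1 : I z = 0 := Set.indicator_of_notMem (s := {z | |pairForm u z| ≤ η}) h _
      have h2 : Real.log (f ((z.2 - inner ℝ θ.1 z.1) / θ.2)) ≤
          Real.log C - |(z.2 - inner ℝ θ.1 z.1) / θ.2| ^ α := by
        have := Real.log_le_log (hpos _) (htail ((z.2 - inner ℝ θ.1 z.1) / θ.2))
        rwa [Real.log_mul hC.ne' (Real.exp_pos _).ne', Real.log_exp] at this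
      have h3 : Real.log C ≤ K := le_max_right _ _
      have h4 : V ≤ |(z.2 - inner ℝ θ.1 z.1) / θ.2| ^ α := by
        refine Real.rpow_le_rpow (by positivity) ?_ hα.le
        rw [abs_div, abs_of_pos hs]
        refine div_le_div_of_nonneg_right ?_ hs.le
        rw [hz, abs_mul, abs_inv, abs_of_pos hw, not_le, inv_mul_eq_div, lt_div_iff₀ hw] at h
        exact h.le
      rw [h1, unitLogLik]; linarith
  calc ∑ i ∈ Finset.range n, unitLogLik f θ (z i)
      ≤ ∑ i ∈ Finset.range n, ((-Real.log θ.2 + K - V) + V * I (z i)) :=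
        Finset.sum_le_sum fun i _ => hterm (z i)
    _ = n * (-Real.log θ.2 + K - V) + V * ∑ i ∈ Finset.range n, I (z i) := by
        rw [Finset.sum_add_distrib, ← Finset.mul_sum]; simp; ring
    _ ≤ n * (-Real.log θ.2 + K - V) + V * (n * (1 / 2)) := by
        gcongr; exact hslab u hu1
    _ = _ := by ring

/-- If every parameter outside a ball around `θ₀` has strictly smaller likelihood than `θ₀`, then
a maximum likelihood estimate exists, and every such estimate lies in the ball. -/
lemma exists_isMLE_of_forall_lt (hf : IsReferenceDensity f) (hpos : ∀ t, 0 < f t)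
    (x : ℕ → EuclideanSpace ℝ (Fin d)) (y : ℕ → ℝ) (n : ℕ)
    {θ₀ : EuclideanSpace ℝ (Fin d) × ℝ} {r : ℝ} (hr : 0 < r) (hrs : r < θ₀.2)
    (hlt : ∀ θ : EuclideanSpace ℝ (Fin d) × ℝ, 0 < θ.2 → r ≤ dist θ θ₀ →
      ∑ i ∈ Finset.range n, unitLogLik f θ (x i, y i)
        < ∑ i ∈ Finset.range n, unitLogLik f θ₀ (x i, y i)) :
    (∃ θ, IsMLE f x y n θ) ∧ ∀ θ, IsMLE f x y n θ → dist θ θ₀ < r := by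
  have hpos' : ∀ θ ∈ Metric.closedBall θ₀ r, 0 < θ.2 := by
    intro θ hθ
    rw [Metric.mem_closedBall, dist_eq_norm] at hθ
    have := (norm_snd_le (θ - θ₀)).trans hθ
    have := (abs_le.1 this).1
    simp only [Prod.snd_sub] at this
    linarith
  constructor
  · have hcont : ContinuousOn (fun θ : EuclideanSpace ℝ (Fin d) × ℝ =>
        ∑ i ∈ Finset.range n, unitLogLik f θ (x i, y i)) (Metric.closedBall θ₀ r) := by
      refine continuousOn_finsetSum _ fun i _ => ?_
      unfold unitLogLik
      refine ContinuousOn.add (ContinuousOn.neg (ContinuousOn.log (by fun_prop)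
        fun θ hθ => (hpos' θ hθ).ne')) (ContinuousOn.log (hf.continuous.comp_continuousOn
          (ContinuousOn.div (by fun_prop) (by fun_prop) fun θ hθ => (hpos' θ hθ).ne'))
          fun θ _ => (hpos _).ne')
    obtain ⟨θ, hθ, hmax⟩ := (isCompact_closedBall θ₀ r).exists_isMaxOn
      ⟨θ₀, Metric.mem_closedBall_self hr.le⟩ hcont
    refine ⟨θ, hpos' θ hθ, fun β s hs => ?_⟩
    rw [logLik_eq_coe_sum hpos, logLik_eq_coe_sum hpos, EReal.coe_le_coe_iff]
    by_cases h : (β, s) ∈ Metric.closedBall θ₀ r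
    · exact hmax h
    · rw [Metric.mem_closedBall, not_le] at h
      exact (hlt (β, s) hs h.le).le.trans (hmax (Metric.mem_closedBall_self hr.le))
  · intro θ hθ
    by_contra h
    have h1 := hθ.2 θ₀.1 θ₀.2 (hr.trans hrs)
    rw [logLik_eq_coe_sum hpos, logLik_eq_coe_sum hpos, EReal.coe_le_coe_iff] at h1
    exact absurd (hlt θ hθ.1 (not_lt.1 h)) (not_lt.2 h1)

end Deterministic

/-! ### Normalization and identifiability of the location-scale family. -/

section ScaleFamily

variable {f : ℝ → ℝ}

lemma IsReferenceDensity.lintegral_scaleDensity_sub (hf : IsReferenceDensity f) {s : ℝ}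
    (hs : 0 < s) (c : ℝ) : ∫⁻ t, ENNReal.ofReal (scaleDensity f s (t - c)) = 1 := by
  have hi : Integrable (fun t => scaleDensity f s (t - c)) :=
    (((hf.integrable.comp_div hs.ne').const_mul s⁻¹).comp_sub_right c)
  rw [← ofReal_integral_eq_lintegral_ofReal hi
    (Eventually.of_forall fun t => mul_nonneg (inv_nonneg.2 hs.le) (hf.nonneg _)),
    integral_sub_right_eq_self (fun t => scaleDensity f s t) c]
  simp only [scaleDensity]
  rw [integral_const_mul, Measure.integral_comp_div, hf.integral_eq_one, abs_of_pos hs]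
  simp [hs.ne']

/-- Identifiability of location and scale. -/
lemma IsReferenceDensity.location_scale_unique (hf : IsReferenceDensity f)
    (hmono : AntitoneOn f (Set.Ici 0)) (hpos : ∀ t, 0 < f t)
    (hlim : Tendsto f atTop (𝓝 0)) {s s₀ c : ℝ} (hs : 0 < s) (hs₀ : 0 < s₀)
    (h : ∀ t, scaleDensity f s (t - c) = scaleDensity f s₀ t) : s = s₀ ∧ c = 0 := by
  have hmax : ∀ t, f t ≤ f 0 := fun t => hf.le_of_abs_le hmono (by simp)
  simp only [scaleDensity] at h
  -- The peak heights must agree: evaluating at `0` and at `c` places the peak of each density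
  -- against some value of the other.
  have hss : s = s₀ := by
    apply le_antisymm
    · have h1 := h 0
      have h2 : s₀⁻¹ * f 0 ≤ s⁻¹ * f 0 := by
        rw [zero_div] at h1
        rw [← h1]
        exact mul_le_mul_of_nonneg_left (hmax _) (inv_nonneg.2 hs.le)
      exact (inv_le_inv₀ hs₀ hs).1 (le_of_mul_le_mul_right h2 (hpos 0))
    · have h1 := h c
      have h2 : s⁻¹ * f 0 ≤ s₀⁻¹ * f 0 := by
        rw [sub_self, zero_div] at h1
        rw [h1]
        exact mul_le_mul_of_nonneg_left (hmax _) (inv_nonneg.2 hs₀.le)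
      exact (inv_le_inv₀ hs hs₀).1 (le_of_mul_le_mul_right h2 (hpos 0))
  refine ⟨hss, ?_⟩
  subst hss
  by_contra hc
  -- With equal scales, a nonzero shift makes `f` return to `f 0` along an arithmetic progression,
  -- which contradicts its decay.
  have hper : ∀ n : ℕ, f (n * (|c| / s)) = f 0 := by
    have hstep : ∀ t, f ((t - c) / s) = f (t / s) := fun t =>
      mul_left_cancel₀ (inv_ne_zero hs.ne') (h t)
    have hc' : ∀ n : ℕ, f (n * (c / s)) = f 0 := by
      intro n
      induction n with
      | zero => simp
      | succ n ih =>
        rw [← ih, show ((n + 1 : ℕ) : ℝ) * (c / s) = ((n + 1) * c) / s by push_cast; ring,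
          ← hstep]
        congr 1; ring
    intro n
    rw [← hc' n, ← hf.apply_abs (n * (c / s)), abs_mul, abs_div, abs_of_pos hs, Nat.abs_cast]
  have h1 : Tendsto (fun n : ℕ => f (n * (|c| / s))) atTop (𝓝 0) :=
    hlim.comp (tendsto_natCast_atTop_atTop.atTop_mul_const (div_pos (abs_pos.2 hc) hs))
  simp only [hper] at h1
  exact (hpos 0).ne' (tendsto_nhds_unique tendsto_const_nhds h1)

lemma tendsto_zero_of_le_exp_neg_rpow (hf : IsReferenceDensity f) {α C : ℝ} (hα : 0 < α)
    (htail : ∀ t, f t ≤ C * Real.exp (-(|t| ^ α))) : Tendsto f atTop (𝓝 0) := by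
  refine squeeze_zero hf.nonneg htail ?_
  have : Tendsto (fun t : ℝ => Real.exp (-(|t| ^ α))) atTop (𝓝 0) :=
    Real.tendsto_exp_neg_atTop_nhds_zero.comp
      ((tendsto_rpow_atTop hα).comp tendsto_abs_atTop_atTop)
  simpa using this.const_mul C

end ScaleFamily

/-! ### A single observation: nondegeneracy, information inequality, integrability. -/

section Model

variable {d : ℕ} {Ω : Type*} [MeasurableSpace Ω] {P : Measure Ω}
  {f : ℝ → ℝ} {β₀ : EuclideanSpace ℝ (Fin d)} {s₀ : ℝ}
  {X : Ω → EuclideanSpace ℝ (Fin d)} {ε Y : Ω → ℝ}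

lemma ae_inner_ne_zero (hX : HasPDF X P volume) {b : EuclideanSpace ℝ (Fin d)} (hb : b ≠ 0) :
    ∀ᵐ ω ∂P, inner ℝ b (X ω) ≠ 0 := by
  have h : ∀ᵐ x : EuclideanSpace ℝ (Fin d), inner ℝ b x ≠ 0 := by
    have h1 : (volume : Measure (EuclideanSpace ℝ (Fin d)))
        (LinearMap.ker (innerSL ℝ b).toLinearMap) = 0 := by
      apply Measure.addHaar_submodule
      intro h
      have h2 : b ∈ LinearMap.ker (innerSL ℝ b).toLinearMap := h ▸ Submodule.mem_top
      simp at h2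
      exact hb h2
    rw [ae_iff]
    convert h1 using 2
    ext x
    simp
  exact ae_of_ae_map hX.aemeasurable (hX.absolutelyContinuous.ae_le h)

variable [IsProbabilityMeasure P]

/-- A nontrivial linear form in `(X, Y)` almost surely does not vanish. -/
lemma ae_pairForm_ne_zero (hX : HasPDF X P volume) (hε : AEMeasurable ε P)
    (hY : ∀ᵐ ω ∂P, Y ω = inner ℝ β₀ (X ω) + ε ω) (hind : IndepFun X ε P)
    (hac : P.map ε ≪ volume) {u : EuclideanSpace ℝ (Fin d) × ℝ} (hu : u ≠ 0) :
    ∀ᵐ ω ∂P, pairForm u (X ω, Y ω) ≠ 0 := by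
  by_cases hu2 : u.2 = 0
  · have hu1 : u.1 ≠ 0 := fun h => hu (Prod.ext h hu2)
    filter_upwards [ae_inner_ne_zero hX hu1] with ω hω
    simpa [pairForm, hu2] using hω
  · have hprod := (indepFun_iff_map_prod_eq_prod_map_map hX.aemeasurable hε).1 hind
    have hms : MeasurableSet {p : EuclideanSpace ℝ (Fin d) × ℝ |
        ¬ (inner ℝ u.1 p.1 + u.2 * (inner ℝ β₀ p.1 + p.2) ≠ 0)} := by
      simp only [ne_eq, not_not]
      exact measurableSet_eq_fun (by fun_prop) (by fun_prop)
    have h : ∀ᵐ p ∂(P.map fun ω => (X ω, ε ω)),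
        inner ℝ u.1 p.1 + u.2 * (inner ℝ β₀ p.1 + p.2) ≠ 0 := by
      have : IsProbabilityMeasure (P.map ε) := Measure.isProbabilityMeasure_map hε
      rw [hprod, ae_iff, Measure.measure_prod_null hms]
      -- For fixed `x` the equation determines `t`, and a single point is null for the law of `ε`.
      refine Eventually.of_forall fun x => ?_
      apply hac
      refine measure_mono_null (t := {-(inner ℝ u.1 x) / u.2 - inner ℝ β₀ x}) ?_ (by simp)
      intro t ht
      simp only [ne_eq, not_not, Set.preimage_ofPred_eq, Set.mem_ofPred_eq] at ht
      rw [Set.mem_singleton_iff]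
      field_simp
      linarith
    have h2 := ae_of_ae_map (hX.aemeasurable.prodMk hε) h
    filter_upwards [h2, hY] with ω h1 h3
    simpa [pairForm, h3] using h1

/-- Given `X = x`, the density of `ε` cancels the denominator and leaves the integral of a
translated probability density. -/
lemma lintegral_ratio_eq_one (hf : IsReferenceDensity f) (hpos : ∀ t, 0 < f t) (hs₀ : 0 < s₀)
    (hX : HasPDF X P volume) (hε : AEMeasurable ε P) (hind : IndepFun X ε P)
    (hdens : P.map ε = volume.withDensity (fun t => ENNReal.ofReal (scaleDensity f s₀ t)))
    (b : EuclideanSpace ℝ (Fin d)) {s : ℝ} (hs : 0 < s) :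
    ∫⁻ ω, ENNReal.ofReal (scaleDensity f s (ε ω - inner ℝ b (X ω)) / scaleDensity f s₀ (ε ω)) ∂P
      = 1 := by
  have hfm : Measurable f := hf.continuous.measurable
  have hprod := (indepFun_iff_map_prod_eq_prod_map_map hX.aemeasurable hε).1 hind
  have : IsProbabilityMeasure (P.map ε) := Measure.isProbabilityMeasure_map hε
  have : IsProbabilityMeasure (P.map X) := Measure.isProbabilityMeasure_map hX.aemeasurable
  have hm : Measurable fun p : EuclideanSpace ℝ (Fin d) × ℝ =>
      ENNReal.ofReal (scaleDensity f s (p.2 - inner ℝ b p.1) / scaleDensity f s₀ p.2) := by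
    unfold scaleDensity; fun_prop
  rw [← lintegral_map' (f := fun p : EuclideanSpace ℝ (Fin d) × ℝ =>
      ENNReal.ofReal (scaleDensity f s (p.2 - inner ℝ b p.1) / scaleDensity f s₀ p.2))
      hm.aemeasurable (hX.aemeasurable.prodMk hε), hprod, lintegral_prod _ hm.aemeasurable]
  have hin : ∀ x : EuclideanSpace ℝ (Fin d), ∫⁻ t, ENNReal.ofReal
      (scaleDensity f s (t - inner ℝ b x) / scaleDensity f s₀ t) ∂(P.map ε) = 1 := by
    intro x
    have hm1 : Measurable fun t => ENNReal.ofReal (scaleDensity f s₀ t) := by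
      unfold scaleDensity; fun_prop
    have hm2 : Measurable fun t => ENNReal.ofReal
        (scaleDensity f s (t - inner ℝ b x) / scaleDensity f s₀ t) :=
      hm.comp (measurable_const.prodMk measurable_id)
    rw [hdens, lintegral_withDensity_eq_lintegral_mul _ hm1 hm2,
      ← hf.lintegral_scaleDensity_sub hs (inner ℝ b x)]
    refine lintegral_congr fun t => ?_
    have h0 : 0 < scaleDensity f s₀ t := mul_pos (inv_pos.2 hs₀) (hpos _)
    rw [Pi.mul_apply, ← ENNReal.ofReal_mul h0.le, mul_div_cancel₀ _ h0.ne']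
  simp [hin]

/-- The expected log-likelihood of one observation is uniquely maximal at the true parameter. -/
lemma integral_unitLogLik_lt (hf : IsReferenceDensity f) (hmono : AntitoneOn f (Set.Ici 0))
    (hpos : ∀ t, 0 < f t) (hlim : Tendsto f atTop (𝓝 0)) (hs₀ : 0 < s₀)
    (hX : HasPDF X P volume) (hε : AEMeasurable ε P)
    (hY : ∀ᵐ ω ∂P, Y ω = inner ℝ β₀ (X ω) + ε ω) (hind : IndepFun X ε P)
    (hdens : P.map ε = volume.withDensity (fun t => ENNReal.ofReal (scaleDensity f s₀ t)))
    {θ : EuclideanSpace ℝ (Fin d) × ℝ} (hs : 0 < θ.2) (hne : θ ≠ (β₀, s₀))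
    (hint : Integrable (fun ω => unitLogLik f θ (X ω, Y ω)) P)
    (hint₀ : Integrable (fun ω => unitLogLik f (β₀, s₀) (X ω, Y ω)) P) :
    ∫ ω, unitLogLik f θ (X ω, Y ω) ∂P < ∫ ω, unitLogLik f (β₀, s₀) (X ω, Y ω) ∂P := by
  have hfm : Measurable f := hf.continuous.measurable
  have hsd : ∀ {s : ℝ}, 0 < s → ∀ t, 0 < scaleDensity f s t := fun h t =>
    mul_pos (inv_pos.2 h) (hpos _)
  have hmr : Measurable fun p : EuclideanSpace ℝ (Fin d) × ℝ =>
      scaleDensity f θ.2 (p.2 - inner ℝ (θ.1 - β₀) p.1) / scaleDensity f s₀ p.2 := by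
    unfold scaleDensity; fun_prop
  have hae : AEMeasurable (fun ω => (X ω, ε ω)) P := hX.aemeasurable.prodMk hε
  set r : Ω → ℝ := fun ω =>
    scaleDensity f θ.2 (ε ω - inner ℝ (θ.1 - β₀) (X ω)) / scaleDensity f s₀ (ε ω) with hr
  have hrpos : ∀ ω, 0 < r ω := fun ω => div_pos (hsd hs _) (hsd hs₀ _)
  have hrm : AEMeasurable r P := hmr.comp_aemeasurable hae
  have hr1 : ∫⁻ ω, ENNReal.ofReal (r ω) ∂P = 1 :=
    lintegral_ratio_eq_one hf hpos hs₀ hX hε hind hdens (θ.1 - β₀) hs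
  have hri : Integrable r P := by
    refine ⟨hrm.aestronglyMeasurable, ?_⟩
    rw [hasFiniteIntegral_iff_ofReal (Eventually.of_forall fun ω => (hrpos ω).le), hr1]
    exact ENNReal.one_lt_top
  have hrint : ∫ ω, r ω ∂P = 1 := by
    rw [integral_eq_lintegral_of_nonneg_ae (Eventually.of_forall fun ω => (hrpos ω).le)
      hri.aestronglyMeasurable, hr1, ENNReal.toReal_one]
  have hlog : ∀ᵐ ω ∂P, unitLogLik f θ (X ω, Y ω) - unitLogLik f (β₀, s₀) (X ω, Y ω)
      = Real.log (r ω) := by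
    filter_upwards [hY] with ω hω
    rw [hr]
    simp only [unitLogLik, scaleDensity]
    rw [Real.log_div (mul_pos (inv_pos.2 hs) (hpos _)).ne' (mul_pos (inv_pos.2 hs₀) (hpos _)).ne',
      Real.log_mul (inv_pos.2 hs).ne' (hpos _).ne', Real.log_mul (inv_pos.2 hs₀).ne' (hpos _).ne',
      Real.log_inv, Real.log_inv, hω,
      show inner ℝ β₀ (X ω) + ε ω - inner ℝ θ.1 (X ω) = ε ω - inner ℝ (θ.1 - β₀) (X ω) by
        rw [inner_sub_left]; ring, add_sub_cancel_left]
  have hli : Integrable (fun ω => Real.log (r ω)) P := (hint.sub hint₀).congr hlog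
  -- Since `r` has mean one, the gap between the two expectations is the mean of `r - 1 - log r ≥
  -- 0`, so equality forces `r = 1` almost surely.
  have hgi : Integrable (fun ω => r ω - 1 - Real.log (r ω)) P :=
    (hri.sub (integrable_const 1)).sub hli
  have hg0 : 0 ≤ᵐ[P] fun ω => r ω - 1 - Real.log (r ω) :=
    Eventually.of_forall fun ω => sub_nonneg.2 (Real.log_le_sub_one_of_pos (hrpos ω))
  have hval : ∫ ω, (r ω - 1 - Real.log (r ω)) ∂P = -∫ ω, Real.log (r ω) ∂P := by
    have h1 : Integrable (fun ω => r ω - 1) P := hri.sub (integrable_const 1)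
    rw [integral_sub h1 hli, integral_sub hri (integrable_const 1), hrint]
    simp
  rw [← sub_neg, ← integral_sub hint hint₀, integral_congr_ae hlog]
  have hnn := integral_nonneg_of_ae hg0
  rw [hval] at hnn
  refine lt_of_le_of_ne (by linarith) fun h0 => hne ?_
  rw [h0, neg_zero, integral_eq_zero_iff_of_nonneg_ae hg0 hgi] at hval
  have hr_one : ∀ᵐ ω ∂P, r ω = 1 := by
    filter_upwards [hval] with ω hω
    by_contra hne1
    have := Real.log_lt_sub_one_of_pos (hrpos ω) hne1
    simp only [Pi.zero_apply] at hω
    linarith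
  have hprod := (indepFun_iff_map_prod_eq_prod_map_map hX.aemeasurable hε).1 hind
  have : IsProbabilityMeasure (P.map ε) := Measure.isProbabilityMeasure_map hε
  have : IsProbabilityMeasure (P.map X) := Measure.isProbabilityMeasure_map hX.aemeasurable
  have hmap : ∀ᵐ p ∂(P.map fun ω => (X ω, ε ω)),
      scaleDensity f θ.2 (p.2 - inner ℝ (θ.1 - β₀) p.1) / scaleDensity f s₀ p.2 = 1 :=
    (ae_map_iff hae (measurableSet_eq_fun hmr measurable_const)).2 hr_one
  rw [hprod] at hmap
  -- Positivity of `f` turns statements valid for almost every `ε` into Lebesgue almost everywhere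
  -- ones; continuity then gives equality of the densities at every point.
  have hvol : volume ≪ P.map ε := by
    rw [hdens]
    refine withDensity_absolutelyContinuous' (by unfold scaleDensity; fun_prop) ?_
    exact Eventually.of_forall fun t => (ENNReal.ofReal_pos.2 (hsd hs₀ t)).ne'
  have hall : ∀ᵐ x ∂(P.map X), θ.2 = s₀ ∧ inner ℝ (θ.1 - β₀) x = 0 := by
    filter_upwards [Measure.ae_ae_of_ae_prod hmap] with x hx
    refine hf.location_scale_unique hmono hpos hlim hs hs₀ ?_
    have h1 : (fun t => scaleDensity f θ.2 (t - inner ℝ (θ.1 - β₀) x))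
        =ᵐ[volume] fun t => scaleDensity f s₀ t := by
      filter_upwards [hvol.ae_le hx] with t ht
      exact (div_eq_one_iff_eq (hsd hs₀ _).ne').1 ht
    have hfc := hf.continuous
    refine congrFun (Measure.eq_of_ae_eq h1 ?_ ?_) <;> unfold scaleDensity <;> fun_prop
  have hall' := ae_of_ae_map hX.aemeasurable hall
  obtain ⟨ω, hω⟩ := hall'.exists
  have hb : θ.1 - β₀ = 0 := by
    by_contra hb
    obtain ⟨ω', h1, h2⟩ := (hall'.and (ae_inner_ne_zero hX hb)).exists
    exact h2 h1.2
  exact Prod.ext (sub_eq_zero.1 hb) hω.1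

/-- Finiteness of the envelopes of the log-likelihood forces the density to be positive. -/
lemma IsReferenceDensity.pos_of_lintegral_lt_top (hf : IsReferenceDensity f)
    (hmono : AntitoneOn f (Set.Ici 0)) (hXm : AEMeasurable X P) (hYm : AEMeasurable Y P)
    (hY0 : ∀ᵐ ω ∂P, Y ω ≠ 0)
    (henv : ∀ R > 0, ∀ a > 0,
      ∫⁻ ω, (extLog (f ((|Y ω| + R * ‖X ω‖) / a))).abs ^ 2 ∂P < ∞) (t : ℝ) : 0 < f t := by
  by_contra hcon
  have ht : f |t| = 0 := by
    rw [hf.apply_abs]; exact le_antisymm (not_lt.1 hcon) (hf.nonneg t)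
  -- By monotonicity `f` vanishes beyond `|t|`, where the envelope is infinite, so its integrability
  -- makes that event null. Scales `1 / (k + 1)` for all `k` then leave only `Y = 0`.
  have hnull : ∀ k : ℕ, ∀ᵐ ω ∂P, (|Y ω| + 1 * ‖X ω‖) / (1 / ((k : ℝ) + 1)) < |t| := by
    intro k
    have ha : 0 < 1 / ((k : ℝ) + 1) := by positivity
    by_contra hne
    have hSm : NullMeasurableSet
        {ω | |t| ≤ (|Y ω| + 1 * ‖X ω‖) / (1 / ((k : ℝ) + 1))} P :=
      nullMeasurableSet_le aemeasurable_const (by fun_prop)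
    have hS : P {ω | |t| ≤ (|Y ω| + 1 * ‖X ω‖) / (1 / ((k : ℝ) + 1))} ≠ 0 := by
      simpa [ae_iff] using hne
    have h1 : ∫⁻ ω, Set.indicator {ω | |t| ≤ (|Y ω| + 1 * ‖X ω‖) / (1 / ((k : ℝ) + 1))}
        (fun _ => ∞) ω ∂P ≤
        ∫⁻ ω, (extLog (f ((|Y ω| + 1 * ‖X ω‖) / (1 / ((k : ℝ) + 1))))).abs ^ 2 ∂P := by
      refine lintegral_mono fun ω => ?_
      by_cases hω : ω ∈ {ω | |t| ≤ (|Y ω| + 1 * ‖X ω‖) / (1 / ((k : ℝ) + 1))}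
      swap
      · rw [Set.indicator_of_notMem hω]; exact zero_le
      have h2 : f ((|Y ω| + 1 * ‖X ω‖) / (1 / ((k : ℝ) + 1))) = 0 :=
        le_antisymm (ht ▸ hf.le_of_abs_le hmono (by
          rw [abs_abs]; exact le_trans hω (le_abs_self _))) (hf.nonneg _)
      rw [h2]
      simp [extLog]
    rw [lintegral_indicator_const₀ hSm, ENNReal.top_mul hS] at h1
    exact absurd (henv 1 one_pos _ ha) (not_lt.2 h1)
  obtain ⟨ω, hω, hω0⟩ := ((ae_all_iff.2 hnull).and hY0).exists
  obtain ⟨k, hk⟩ := exists_nat_gt (|t| / |Y ω|)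
  have h1 := hω k
  rw [div_lt_iff₀ (abs_pos.2 hω0)] at hk
  rw [div_div_eq_mul_div, div_one] at h1
  have h3 : (k : ℝ) * |Y ω| ≤ (|Y ω| + 1 * ‖X ω‖) * (k + 1) := by
    have := norm_nonneg (X ω)
    have := abs_nonneg (Y ω)
    have : (0 : ℝ) ≤ k := k.cast_nonneg
    nlinarith [mul_nonneg ‹(0 : ℝ) ≤ k› ‹0 ≤ ‖X ω‖›]
  linarith

lemma integrable_log_envelope (hf : IsReferenceDensity f) (hpos : ∀ t, 0 < f t)
    (hXm : AEMeasurable X P) (hYm : AEMeasurable Y P)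
    (henv : ∀ R > 0, ∀ a > 0,
      ∫⁻ ω, (extLog (f ((|Y ω| + R * ‖X ω‖) / a))).abs ^ 2 ∂P < ∞)
    {R a : ℝ} (hR : 0 < R) (ha : 0 < a) :
    Integrable (fun ω => Real.log (f ((|Y ω| + R * ‖X ω‖) / a))) P := by
  have hfm : Measurable f := hf.continuous.measurable
  refine ⟨AEMeasurable.aestronglyMeasurable (by fun_prop), ?_⟩
  have hle : ∀ x : ℝ≥0∞, x ≤ 1 + x ^ 2 := by
    intro x
    rcases le_total x 1 with h | h
    · exact h.trans le_self_add
    · exact (le_self_pow h two_ne_zero).trans le_add_self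
  calc ∫⁻ ω, ‖Real.log (f ((|Y ω| + R * ‖X ω‖) / a))‖ₑ ∂P
      ≤ ∫⁻ ω, (1 + (extLog (f ((|Y ω| + R * ‖X ω‖) / a))).abs ^ 2) ∂P := by
        refine lintegral_mono fun ω => ?_
        rw [extLog_of_pos (hpos _), EReal.abs_def, ← Real.enorm_eq_ofReal_abs]
        exact hle _
    _ = 1 + ∫⁻ ω, (extLog (f ((|Y ω| + R * ‖X ω‖) / a))).abs ^ 2 ∂P := by
        rw [lintegral_add_left measurable_const]; simp
    _ < ∞ := ENNReal.add_lt_top.2 ⟨ENNReal.one_lt_top, henv R hR a ha⟩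

/-- The integrand lies between an envelope with `R = ‖θ.1‖ + 1` and the constant `log f 0`; the
extra `1` keeps `R` positive when `θ.1 = 0`. -/
lemma integrable_log_residual (hf : IsReferenceDensity f) (hmono : AntitoneOn f (Set.Ici 0))
    (hpos : ∀ t, 0 < f t) (hXm : AEMeasurable X P) (hYm : AEMeasurable Y P)
    (henv : ∀ R > 0, ∀ a > 0,
      ∫⁻ ω, (extLog (f ((|Y ω| + R * ‖X ω‖) / a))).abs ^ 2 ∂P < ∞)
    (θ : EuclideanSpace ℝ (Fin d) × ℝ) (hs : 0 < θ.2) :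
    Integrable (fun ω => Real.log (f ((Y ω - inner ℝ θ.1 (X ω)) / θ.2))) P := by
  have hfm : Measurable f := hf.continuous.measurable
  refine ((integrable_log_envelope hf hpos hXm hYm henv (R := ‖θ.1‖ + 1) (by positivity)
    hs).abs.add (integrable_const |Real.log (f 0)|)).mono'
    (AEMeasurable.aestronglyMeasurable (by fun_prop)) (Eventually.of_forall fun ω => ?_)
  have h1 : Real.log (f ((Y ω - inner ℝ θ.1 (X ω)) / θ.2)) ≤ Real.log (f 0) :=
    hf.log_le_of_abs_le hmono hpos (by simp)
  have h2 : Real.log (f ((|Y ω| + (‖θ.1‖ + 1) * ‖X ω‖) / θ.2)) ≤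
      Real.log (f ((Y ω - inner ℝ θ.1 (X ω)) / θ.2)) := by
    apply hf.log_le_of_abs_le hmono hpos
    rw [abs_div, abs_div]
    refine div_le_div_of_nonneg_right ?_ (abs_nonneg _)
    refine le_trans ?_ (le_abs_self _)
    have h3 := abs_sub (Y ω) (inner ℝ θ.1 (X ω))
    have h4 := abs_real_inner_le_norm θ.1 (X ω)
    have h5 := norm_nonneg (X ω)
    linarith
  rw [Real.norm_eq_abs]
  simp only [Pi.add_apply]
  refine abs_le.2 ⟨?_, ?_⟩
  · have := neg_abs_le (Real.log (f ((|Y ω| + (‖θ.1‖ + 1) * ‖X ω‖) / θ.2)))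
    have := abs_nonneg (Real.log (f 0))
    linarith
  · have := abs_nonneg (Real.log (f ((|Y ω| + (‖θ.1‖ + 1) * ‖X ω‖) / θ.2)))
    have := le_abs_self (Real.log (f 0))
    linarith

lemma integrable_unitLogLik (hf : IsReferenceDensity f) (hmono : AntitoneOn f (Set.Ici 0))
    (hpos : ∀ t, 0 < f t) (hXm : AEMeasurable X P) (hYm : AEMeasurable Y P)
    (henv : ∀ R > 0, ∀ a > 0,
      ∫⁻ ω, (extLog (f ((|Y ω| + R * ‖X ω‖) / a))).abs ^ 2 ∂P < ∞)
    (θ : EuclideanSpace ℝ (Fin d) × ℝ) (hs : 0 < θ.2) :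
    Integrable (fun ω => unitLogLik f θ (X ω, Y ω)) P :=
  (integrable_const _).add (integrable_log_residual hf hmono hpos hXm hYm henv θ hs)

/-- The expected local majorants decrease to the expected log-likelihood. -/
lemma exists_integral_localMajorant_lt (hf : IsReferenceDensity f)
    (hmono : AntitoneOn f (Set.Ici 0)) (hpos : ∀ t, 0 < f t) (hXm : AEMeasurable X P)
    (hYm : AEMeasurable Y P)
    (henv : ∀ R > 0, ∀ a > 0,
      ∫⁻ ω, (extLog (f ((|Y ω| + R * ‖X ω‖) / a))).abs ^ 2 ∂P < ∞)
    (θ : EuclideanSpace ℝ (Fin d) × ℝ) (hs : 0 < θ.2) {c : ℝ}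
    (hc : ∫ ω, unitLogLik f θ (X ω, Y ω) ∂P < c) :
    ∃ ρ > 0, ρ < θ.2 ∧ Integrable (fun ω => localMajorant f θ ρ (X ω, Y ω)) P ∧
      ∫ ω, localMajorant f θ ρ (X ω, Y ω) ∂P < c := by
  have hfm : Measurable f := hf.continuous.measurable
  have hi := integrable_log_residual hf hmono hpos hXm hYm henv θ hs
  set G : ℝ → Ω → ℝ := fun ρ ω =>
    Real.log (f (max (|Y ω - inner ℝ θ.1 (X ω)| - ρ * ‖X ω‖) 0 / (θ.2 + ρ))) with hG
  -- `G ρ` lies between the log-density of the residual at `θ` and `log f 0`, so `b` dominates it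
  -- for every `ρ > 0`.
  set b : Ω → ℝ := fun ω =>
    |Real.log (f ((Y ω - inner ℝ θ.1 (X ω)) / θ.2))| + |Real.log (f 0)| with hb
  have hbi : Integrable b P := hi.abs.add (integrable_const _)
  have hGm : ∀ ρ, AEStronglyMeasurable (G ρ) P := fun ρ =>
    AEMeasurable.aestronglyMeasurable (by fun_prop)
  have hGb : ∀ ρ > 0, ∀ ω, ‖G ρ ω‖ ≤ b ω := by
    intro ρ hρ ω
    have h1 : G ρ ω ≤ Real.log (f 0) := hf.log_le_of_abs_le hmono hpos (by simp)
    have h2 : Real.log (f ((Y ω - inner ℝ θ.1 (X ω)) / θ.2)) ≤ G ρ ω := by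
      apply hf.log_le_of_abs_le hmono hpos
      rw [abs_div, abs_div, abs_of_nonneg (le_max_right _ _), abs_of_pos hs,
        abs_of_pos (by linarith : 0 < θ.2 + ρ)]
      refine div_le_div₀ (abs_nonneg _) (max_le ?_ (abs_nonneg _)) hs (by linarith)
      have : 0 ≤ ρ * ‖X ω‖ := by positivity
      linarith
    rw [Real.norm_eq_abs]
    refine abs_le.2 ⟨?_, ?_⟩
    · have := neg_abs_le (Real.log (f ((Y ω - inner ℝ θ.1 (X ω)) / θ.2)))
      have := abs_nonneg (Real.log (f 0))
      simp only [hb]; linarith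
    · have := abs_nonneg (Real.log (f ((Y ω - inner ℝ θ.1 (X ω)) / θ.2)))
      have := le_abs_self (Real.log (f 0))
      simp only [hb]; linarith
  have hGi : ∀ ρ > 0, Integrable (G ρ) P := fun ρ hρ =>
    hbi.mono' (hGm ρ) (Eventually.of_forall (hGb ρ hρ))
  have hlim : Tendsto (fun ρ => ∫ ω, G ρ ω ∂P) (𝓝[>] 0)
      (𝓝 (∫ ω, Real.log (f ((Y ω - inner ℝ θ.1 (X ω)) / θ.2)) ∂P)) := by
    refine tendsto_integral_filter_of_dominated_convergence b (Eventually.of_forall hGm) ?_ hbi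
      (Eventually.of_forall fun ω => ?_)
    · filter_upwards [self_mem_nhdsWithin] with ρ hρ using Eventually.of_forall (hGb ρ hρ)
    · have hval : Real.log (f ((Y ω - inner ℝ θ.1 (X ω)) / θ.2)) = G 0 ω := by
        simp only [hG, zero_mul, sub_zero, add_zero]
        rw [max_eq_left (abs_nonneg _), ← hf.apply_abs, abs_div, abs_of_pos hs]
      rw [hval]
      have hcont : ContinuousAt (fun ρ => G ρ ω) 0 := by
        refine ContinuousAt.log (hf.continuous.continuousAt.comp (ContinuousAt.div (by fun_prop)
          (by fun_prop) (by simpa using hs.ne'))) (hpos _).ne'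
      exact hcont.tendsto.mono_left nhdsWithin_le_nhds
  have hlim2 : Tendsto (fun ρ => -Real.log (θ.2 - ρ) + ∫ ω, G ρ ω ∂P) (𝓝[>] 0)
      (𝓝 (-Real.log θ.2 + ∫ ω, Real.log (f ((Y ω - inner ℝ θ.1 (X ω)) / θ.2)) ∂P)) := by
    refine Tendsto.add (Tendsto.neg ?_) hlim
    have hcont : ContinuousAt (fun ρ => Real.log (θ.2 - ρ)) 0 :=
      ContinuousAt.log (by fun_prop) (by simpa using hs.ne')
    have := hcont.tendsto.mono_left (nhdsWithin_le_nhds (s := Set.Ioi 0))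
    simpa using this
  have hc' : -Real.log θ.2 + ∫ ω, Real.log (f ((Y ω - inner ℝ θ.1 (X ω)) / θ.2)) ∂P < c := by
    have h1 : ∫ ω, unitLogLik f θ (X ω, Y ω) ∂P =
        -Real.log θ.2 + ∫ ω, Real.log (f ((Y ω - inner ℝ θ.1 (X ω)) / θ.2)) ∂P := by
      unfold unitLogLik
      rw [integral_add (integrable_const _) hi]; simp
    rwa [← h1]
  have hev := (hlim2.eventually (gt_mem_nhds hc')).and
    (Ioo_mem_nhdsGT hs)
  obtain ⟨ρ, h1, h2⟩ := hev.exists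
  refine ⟨ρ, h2.1, h2.2, (integrable_const _).add (hGi ρ h2.1), ?_⟩
  have h3 : ∫ ω, localMajorant f θ ρ (X ω, Y ω) ∂P = -Real.log (θ.2 - ρ) + ∫ ω, G ρ ω ∂P := by
    unfold localMajorant
    rw [integral_add (integrable_const _) (hGi ρ h2.1)]; simp
  rwa [h3]

end Model

/-! ### Strong laws, uniform slab counts and coercivity for the sample. -/

section Sample

variable {d : ℕ} {Ω : Type*} [MeasurableSpace Ω] {P : Measure Ω}
  {f : ℝ → ℝ} {X : Ω → EuclideanSpace ℝ (Fin d)} {Y : Ω → ℝ}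
  {Xs : ℕ → Ω → EuclideanSpace ℝ (Fin d)} {Ys : ℕ → Ω → ℝ}

lemma ae_tendsto_average (hindep : iIndepFun (fun i ω => (Xs i ω, Ys i ω)) P)
    (hident : ∀ i, IdentDistrib (fun ω => (Xs i ω, Ys i ω)) (fun ω => (X ω, Y ω)) P P)
    {g : EuclideanSpace ℝ (Fin d) × ℝ → ℝ} (hg : Measurable g)
    (hint : Integrable (fun ω => g (X ω, Y ω)) P) :
    ∀ᵐ ω ∂P, Tendsto (fun n : ℕ => (∑ i ∈ Finset.range n, g (Xs i ω, Ys i ω)) / n) atTop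
      (𝓝 (∫ ω, g (X ω, Y ω) ∂P)) := by
  have hid : ∀ i, IdentDistrib (fun ω => g (Xs i ω, Ys i ω)) (fun ω => g (X ω, Y ω)) P P :=
    fun i => (hident i).comp hg
  rw [← (hid 0).integral_eq]
  exact strong_law_ae_real (fun i ω => g (Xs i ω, Ys i ω)) ((hid 0).integrable_iff.2 hint)
    (fun i j hij => (hindep.indepFun hij).comp hg hg) fun i => (hid i).trans (hid 0).symm

lemma ae_eventually_sum_lt (hindep : iIndepFun (fun i ω => (Xs i ω, Ys i ω)) P)
    (hident : ∀ i, IdentDistrib (fun ω => (Xs i ω, Ys i ω)) (fun ω => (X ω, Y ω)) P P)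
    {g : EuclideanSpace ℝ (Fin d) × ℝ → ℝ} (hg : Measurable g)
    (hint : Integrable (fun ω => g (X ω, Y ω)) P) {c : ℝ} (hc : ∫ ω, g (X ω, Y ω) ∂P < c) :
    ∀ᵐ ω ∂P, ∀ᶠ n : ℕ in atTop, ∑ i ∈ Finset.range n, g (Xs i ω, Ys i ω) < n * c := by
  filter_upwards [ae_tendsto_average hindep hident hg hint] with ω hω
  filter_upwards [hω.eventually (gt_mem_nhds hc), eventually_gt_atTop 0] with n hn hn0
  rwa [div_lt_iff₀ (by exact_mod_cast hn0), mul_comm] at hn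

lemma ae_eventually_lt_sum (hindep : iIndepFun (fun i ω => (Xs i ω, Ys i ω)) P)
    (hident : ∀ i, IdentDistrib (fun ω => (Xs i ω, Ys i ω)) (fun ω => (X ω, Y ω)) P P)
    {g : EuclideanSpace ℝ (Fin d) × ℝ → ℝ} (hg : Measurable g)
    (hint : Integrable (fun ω => g (X ω, Y ω)) P) {c : ℝ} (hc : c < ∫ ω, g (X ω, Y ω) ∂P) :
    ∀ᵐ ω ∂P, ∀ᶠ n : ℕ in atTop, n * c < ∑ i ∈ Finset.range n, g (Xs i ω, Ys i ω) := by
  filter_upwards [ae_tendsto_average hindep hident hg hint] with ω hω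
  filter_upwards [hω.eventually (lt_mem_nhds hc), eventually_gt_atTop 0] with n hn hn0
  rwa [lt_div_iff₀ (by exact_mod_cast hn0), mul_comm] at hn

/-- As `ρ → 0` these regions shrink to the null hyperplane. Their width grows with `z` so that one
of them contains the slabs of all nearby directions. -/
lemma exists_integral_indicator_slab_lt [IsProbabilityMeasure P]
    (hXm : AEMeasurable X P) (hYm : AEMeasurable Y P)
    {u : EuclideanSpace ℝ (Fin d) × ℝ} (hu : ∀ᵐ ω ∂P, pairForm u (X ω, Y ω) ≠ 0) :
    ∃ ρ > 0, ∫ ω, Set.indicator {z | |pairForm u z| ≤ ρ * (1 + ‖z.1‖ + |z.2|)}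
      (fun _ => (1 : ℝ)) (X ω, Y ω) ∂P < 1 / 2 := by
  have hmp := measurable_pairForm u
  set F : ℝ → Ω → ℝ := fun ρ ω => Set.indicator {z | |pairForm u z| ≤ ρ * (1 + ‖z.1‖ + |z.2|)}
      (fun _ => (1 : ℝ)) (X ω, Y ω) with hF
  have hm : ∀ ρ, AEStronglyMeasurable (F ρ) P := by
    intro ρ
    have : Measurable (Set.indicator {z : EuclideanSpace ℝ (Fin d) × ℝ |
        |pairForm u z| ≤ ρ * (1 + ‖z.1‖ + |z.2|)} (fun _ => (1 : ℝ))) :=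
      measurable_const.indicator (measurableSet_le (by fun_prop) (by fun_prop))
    exact (this.comp_aemeasurable (hXm.prodMk hYm)).aestronglyMeasurable
  have hlim : Tendsto (fun ρ => ∫ ω, F ρ ω ∂P) (𝓝[>] 0) (𝓝 (∫ _, (0 : ℝ) ∂P)) := by
    refine tendsto_integral_filter_of_dominated_convergence (fun _ => 1)
      (Eventually.of_forall hm) (Eventually.of_forall fun ρ => Eventually.of_forall fun ω => ?_)
      (integrable_const _) ?_
    · refine (norm_indicator_le_norm_self _ _).trans ?_
      simp
    · filter_upwards [hu] with ω hω
      refine tendsto_const_nhds.congr' ?_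
      have h1 : Tendsto (fun ρ : ℝ => ρ * (1 + ‖X ω‖ + |Y ω|)) (𝓝[>] 0) (𝓝 0) := by
        have : Continuous fun ρ : ℝ => ρ * (1 + ‖X ω‖ + |Y ω|) := by fun_prop
        have h := (this.tendsto 0).mono_left (nhdsWithin_le_nhds (s := Set.Ioi 0))
        rwa [zero_mul] at h
      filter_upwards [h1.eventually (gt_mem_nhds (abs_pos.2 hω))] with ρ hρ
      refine (Set.indicator_of_notMem ?_ _).symm
      exact not_le.2 hρ
  rw [integral_zero] at hlim
  obtain ⟨ρ, h1, h2⟩ := ((hlim.eventually (gt_mem_nhds (by norm_num : (0 : ℝ) < 1 / 2))).and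
    self_mem_nhdsWithin).exists
  exact ⟨ρ, h2, h1⟩

/-- Uniformly over all directions, at most half of the observations are close to a hyperplane. -/
lemma exists_ae_eventually_slab_le [IsProbabilityMeasure P]
    (hindep : iIndepFun (fun i ω => (Xs i ω, Ys i ω)) P)
    (hident : ∀ i, IdentDistrib (fun ω => (Xs i ω, Ys i ω)) (fun ω => (X ω, Y ω)) P P)
    (hXm : AEMeasurable X P) (hYm : AEMeasurable Y P)
    (hnd : ∀ u : EuclideanSpace ℝ (Fin d) × ℝ, u ≠ 0 → ∀ᵐ ω ∂P, pairForm u (X ω, Y ω) ≠ 0) :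
    ∃ η > 0, ∀ᵐ ω ∂P, ∀ᶠ n : ℕ in atTop, ∀ u : EuclideanSpace ℝ (Fin d) × ℝ, ‖u‖ = 1 →
      ∑ i ∈ Finset.range n, Set.indicator {z | |pairForm u z| ≤ η} (fun _ => (1 : ℝ))
        (Xs i ω, Ys i ω) ≤ n * (1 / 2) := by
  have hmono : ∀ (u : EuclideanSpace ℝ (Fin d) × ℝ) {η η' : ℝ}, η ≤ η' → ∀ (n : ℕ) (ω : Ω),
      ∑ i ∈ Finset.range n, Set.indicator {z | |pairForm u z| ≤ η} (fun _ => (1 : ℝ))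
        (Xs i ω, Ys i ω) ≤
      ∑ i ∈ Finset.range n, Set.indicator {z | |pairForm u z| ≤ η'} (fun _ => (1 : ℝ))
        (Xs i ω, Ys i ω) := fun u η η' h n ω =>
    Finset.sum_le_sum fun i _ => Set.indicator_le_indicator_of_subset
      (fun z hz => le_trans hz h) (fun _ => zero_le_one) _
  -- The half-width may depend on the piece of the sphere: a finite union takes the smallest one.
  obtain ⟨η, hη, h⟩ := (isCompact_sphere (0 : EuclideanSpace ℝ (Fin d) × ℝ) 1).induction_on
    (p := fun s => ∃ η > 0, ∀ᵐ ω ∂P, ∀ᶠ n : ℕ in atTop, ∀ u ∈ s,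
      ∑ i ∈ Finset.range n, Set.indicator {z | |pairForm u z| ≤ η} (fun _ => (1 : ℝ))
        (Xs i ω, Ys i ω) ≤ n * (1 / 2))
    ⟨1, one_pos, by simp⟩
    (fun s t hst ⟨η, hη, h⟩ => ⟨η, hη, by
      filter_upwards [h] with ω hω
      filter_upwards [hω] with n hn u hu using hn u (hst hu)⟩)
    (fun s t ⟨η, hη, h⟩ ⟨η', hη', h'⟩ => ⟨min η η', lt_min hη hη', by
      filter_upwards [h, h'] with ω hω hω'
      filter_upwards [hω, hω'] with n hn hn' u hu
      rcases hu with hu | hu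
      · exact (hmono u (min_le_left _ _) n ω).trans (hn u hu)
      · exact (hmono u (min_le_right _ _) n ω).trans (hn' u hu)⟩)
    (fun u hu => by
      have hu0 : u ≠ 0 := by
        rintro rfl
        simp at hu
      obtain ⟨ρ, hρ, hlt⟩ := exists_integral_indicator_slab_lt hXm hYm (hnd u hu0)
      have hmp := measurable_pairForm u
      have hgm : Measurable (Set.indicator {z : EuclideanSpace ℝ (Fin d) × ℝ |
          |pairForm u z| ≤ ρ * (1 + ‖z.1‖ + |z.2|)} (fun _ => (1 : ℝ))) :=
        measurable_const.indicator (measurableSet_le (by fun_prop) (by fun_prop))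
      have hgi : Integrable (fun ω => Set.indicator {z : EuclideanSpace ℝ (Fin d) × ℝ |
          |pairForm u z| ≤ ρ * (1 + ‖z.1‖ + |z.2|)} (fun _ => (1 : ℝ)) (X ω, Y ω)) P :=
        (integrable_const (1 : ℝ)).mono'
          (hgm.comp_aemeasurable (hXm.prodMk hYm)).aestronglyMeasurable
          (Eventually.of_forall fun ω => (norm_indicator_le_norm_self _ _).trans (by simp))
      -- For `v` in this ball, `|pairForm v z| ≤ ρ` implies `|pairForm u z| ≤ ρ + ρ * (‖z.1‖ +
      -- |z.2|)`, which is exactly the widened region.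
      refine ⟨Metric.ball u ρ, mem_nhdsWithin_of_mem_nhds (Metric.ball_mem_nhds u hρ), ρ, hρ, ?_⟩
      filter_upwards [ae_eventually_sum_lt hindep hident hgm hgi hlt] with ω hω
      filter_upwards [hω] with n hn v hv
      refine le_trans (Finset.sum_le_sum fun i _ => ?_) hn.le
      refine Set.indicator_le_indicator_of_subset (fun z hz => ?_) (fun _ => zero_le_one) _
      have hz' : |pairForm v z| ≤ ρ := hz
      have h1 := abs_pairForm_sub_le u v z
      have h2 : dist u v * (‖z.1‖ + |z.2|) ≤ ρ * (‖z.1‖ + |z.2|) :=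
        mul_le_mul_of_nonneg_right (dist_comm u v ▸ (Metric.mem_ball.1 hv).le) (by positivity)
      have h3 := abs_sub_abs_le_abs_sub (pairForm u z) (pairForm v z)
      change |pairForm u z| ≤ ρ * (1 + ‖z.1‖ + |z.2|)
      linarith)
  refine ⟨η, hη, ?_⟩
  filter_upwards [h] with ω hω
  filter_upwards [hω] with n hn u hu using hn u (by simpa using hu)

/-- Away from a compact subset of the parameter space the log-likelihood is eventually below
any prescribed level per observation. -/
lemma exists_ae_eventually_sum_lt_of_slab (hf : IsReferenceDensity f)
    (hmono : AntitoneOn f (Set.Ici 0)) (hpos : ∀ t, 0 < f t) {α C : ℝ} (hα : 0 < α)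
    (hC : 0 < C) (htail : ∀ t, f t ≤ C * Real.exp (-(|t| ^ α))) {η : ℝ} (hη : 0 < η)
    (hslab : ∀ᵐ ω ∂P, ∀ᶠ n : ℕ in atTop, ∀ u : EuclideanSpace ℝ (Fin d) × ℝ, ‖u‖ = 1 →
      ∑ i ∈ Finset.range n, Set.indicator {z | |pairForm u z| ≤ η} (fun _ => (1 : ℝ))
        (Xs i ω, Ys i ω) ≤ n * (1 / 2)) (T : ℝ) :
    ∃ K : Set (EuclideanSpace ℝ (Fin d) × ℝ), IsCompact K ∧ (∀ θ ∈ K, 0 < θ.2) ∧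
      ∀ᵐ ω ∂P, ∀ᶠ n : ℕ in atTop, ∀ θ : EuclideanSpace ℝ (Fin d) × ℝ, 0 < θ.2 → θ ∉ K →
        ∑ i ∈ Finset.range n, unitLogLik f θ (Xs i ω, Ys i ω) < n * T := by
  obtain ⟨δ, hδ, S, R, hout⟩ := exists_envelope_lt hα hη
    (max (Real.log (f 0)) (Real.log C)) T
  refine ⟨Metric.closedBall 0 R ×ˢ Set.Icc δ S, (isCompact_closedBall 0 R).prod isCompact_Icc,
    fun θ hθ => hδ.trans_le hθ.2.1, ?_⟩
  filter_upwards [hslab] with ω hω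
  filter_upwards [hω, eventually_gt_atTop 0] with n hn hn0 θ hs hθ
  refine (sum_unitLogLik_le hf hmono hpos hα hC htail hη (fun i => (Xs i ω, Ys i ω)) n hn θ
    hs).trans_lt ?_
  refine mul_lt_mul_of_pos_left (hout θ.2 hs _ (le_max_right _ _) ?_) (by exact_mod_cast hn0)
  by_contra hcon
  push Not at hcon
  refine hθ ⟨?_, hcon.1, hcon.2.1⟩
  rw [mem_closedBall_zero_iff]
  exact (le_max_left _ _).trans hcon.2.2

end Sample

/-! ### Wald's compactness argument. -/

section Consistency

variable {d : ℕ} {Ω : Type*} [MeasurableSpace Ω] {P : Measure Ω}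
  {f : ℝ → ℝ} {X : Ω → EuclideanSpace ℝ (Fin d)} {Y : Ω → ℝ}
  {Xs : ℕ → Ω → EuclideanSpace ℝ (Fin d)} {Ys : ℕ → Ω → ℝ}

/-- Wald's argument: if the expected log-likelihood is uniquely maximal at `θ₀`, has local
majorants with convergent expectations, and the log-likelihood is coercive, then eventually
every parameter outside a given ball around `θ₀` has smaller likelihood than `θ₀`. -/
lemma ae_eventually_sum_unitLogLik_lt (hf : Measurable f)
    (hindep : iIndepFun (fun i ω => (Xs i ω, Ys i ω)) P)
    (hident : ∀ i, IdentDistrib (fun ω => (Xs i ω, Ys i ω)) (fun ω => (X ω, Y ω)) P P)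
    {θ₀ : EuclideanSpace ℝ (Fin d) × ℝ}
    (hint : Integrable (fun ω => unitLogLik f θ₀ (X ω, Y ω)) P)
    (hlocal : ∀ θ : EuclideanSpace ℝ (Fin d) × ℝ, 0 < θ.2 → θ ≠ θ₀ → ∃ ρ > 0,
      (∀ θ' ∈ Metric.ball θ ρ, ∀ z, unitLogLik f θ' z ≤ localMajorant f θ ρ z) ∧
      Integrable (fun ω => localMajorant f θ ρ (X ω, Y ω)) P ∧
      ∫ ω, localMajorant f θ ρ (X ω, Y ω) ∂P < ∫ ω, unitLogLik f θ₀ (X ω, Y ω) ∂P)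
    (hcoercive : ∀ T : ℝ, ∃ K : Set (EuclideanSpace ℝ (Fin d) × ℝ), IsCompact K ∧
      (∀ θ ∈ K, 0 < θ.2) ∧
      ∀ᵐ ω ∂P, ∀ᶠ n : ℕ in atTop, ∀ θ : EuclideanSpace ℝ (Fin d) × ℝ, 0 < θ.2 → θ ∉ K →
        ∑ i ∈ Finset.range n, unitLogLik f θ (Xs i ω, Ys i ω) < n * T)
    {r : ℝ} (hr : 0 < r) :
    ∀ᵐ ω ∂P, ∀ᶠ n : ℕ in atTop, ∀ θ : EuclideanSpace ℝ (Fin d) × ℝ, 0 < θ.2 → r ≤ dist θ θ₀ →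
      ∑ i ∈ Finset.range n, unitLogLik f θ (Xs i ω, Ys i ω)
        < ∑ i ∈ Finset.range n, unitLogLik f θ₀ (Xs i ω, Ys i ω) := by
  have hm₀ := measurable_unitLogLik hf θ₀
  -- Any level strictly below the optimal expectation would do; the average at `θ₀` eventually
  -- exceeds it.
  obtain ⟨K, hK, hK0, hout⟩ := hcoercive (∫ ω, unitLogLik f θ₀ (X ω, Y ω) ∂P - 1)
  have hin : ∀ᵐ ω ∂P, ∀ᶠ n : ℕ in atTop, ∀ θ ∈ K \ Metric.ball θ₀ r,
      ∑ i ∈ Finset.range n, unitLogLik f θ (Xs i ω, Ys i ω)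
        < ∑ i ∈ Finset.range n, unitLogLik f θ₀ (Xs i ω, Ys i ω) := by
    refine (hK.diff Metric.isOpen_ball).induction_on
      (p := fun s => ∀ᵐ ω ∂P, ∀ᶠ n : ℕ in atTop, ∀ θ ∈ s,
        ∑ i ∈ Finset.range n, unitLogLik f θ (Xs i ω, Ys i ω)
          < ∑ i ∈ Finset.range n, unitLogLik f θ₀ (Xs i ω, Ys i ω)) (by simp) ?_ ?_ ?_
    · intro s t hst h
      filter_upwards [h] with ω hω
      filter_upwards [hω] with n hn θ hθ using hn θ (hst hθ)
    · intro s t h h'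
      filter_upwards [h, h'] with ω hω hω'
      filter_upwards [hω, hω'] with n hn hn' θ hθ
      exact hθ.elim (hn θ) (hn' θ)
    · intro θ hθ
      have hne : θ ≠ θ₀ := by
        rintro rfl
        exact hθ.2 (Metric.mem_ball_self hr)
      obtain ⟨ρ, hρ, hle, hρi, hρlt⟩ := hlocal θ (hK0 θ hθ.1) hne
      -- The level `c` separates the averages: the majorant eventually stays below it and the
      -- likelihood at `θ₀` above it.
      obtain ⟨c, hc1, hc2⟩ := exists_between hρlt
      refine ⟨Metric.ball θ ρ, mem_nhdsWithin_of_mem_nhds (Metric.ball_mem_nhds θ hρ), ?_⟩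
      filter_upwards [ae_eventually_sum_lt hindep hident (measurable_localMajorant hf θ ρ) hρi hc1,
        ae_eventually_lt_sum hindep hident hm₀ hint hc2] with ω h1 h2
      filter_upwards [h1, h2] with n hn1 hn2 θ' hθ'
      exact ((Finset.sum_le_sum fun i _ => hle θ' hθ' _).trans_lt hn1).trans hn2
  filter_upwards [hin, hout, ae_eventually_lt_sum hindep hident hm₀ hint (sub_one_lt _)]
    with ω h1 h2 h3
  filter_upwards [h1, h2, h3] with n hn1 hn2 hn3 θ hs hθ
  by_cases hθK : θ ∈ K
  · exact hn1 θ ⟨hθK, fun h => not_lt.2 hθ (Metric.mem_ball.1 h)⟩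
  · exact (hn2 θ hs hθK).trans hn3

end Consistency

/-! ### Assembly of the consistency theorem. -/

theorem theorem2
    {d : ℕ} (hd : 1 ≤ d)
    {Ω : Type*} [MeasurableSpace Ω] (P : Measure Ω) [IsProbabilityMeasure P]
    (f : ℝ → ℝ) (β₀ : EuclideanSpace ℝ (Fin d)) (s₀ : ℝ) (hs₀ : 0 < s₀)
    -- the linear model `Y = β₀ᵀ X + ε`
    (X : Ω → EuclideanSpace ℝ (Fin d)) (ε Y : Ω → ℝ)
    (hε : AEMeasurable ε P)
    (hY : ∀ᵐ ω ∂P, Y ω = inner ℝ β₀ (X ω) + ε ω)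
    -- independence, density of `X`, scale family for `ε`
    (hA1 : IndepFun X ε P)
    (hA2 : HasPDF X P volume)
    (hA3 : IsReferenceDensity f)
    (hA3' : P.map ε = volume.withDensity (fun t => ENNReal.ofReal (scaleDensity f s₀ t)))
    -- tail bound
    (α C : ℝ) (hα : 0 < α) (hC : 0 < C)
    (hA4 : ∀ t, f t ≤ C * Real.exp (-(|t| ^ α)))
    -- integrable log-density at the true parameter
    (hA5 : ∫⁻ ω, (extLog (f ((Y ω - inner ℝ β₀ (X ω)) / s₀))).abs ∂P < ∞)
    -- moments of `X`
    (hA6 : Integrable (fun ω => ‖X ω‖ ^ (max (2 * α) 2)) P)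
    -- monotonicity
    (hA7 : AntitoneOn f (Set.Ici 0))
    -- square-integrable envelopes
    (hA8 : ∀ R > 0, ∀ a > 0,
      ∫⁻ ω, (extLog (f ((|Y ω| + R * ‖X ω‖) / a))).abs ^ 2 ∂P < ∞)
    -- the observations: independent copies of `(X, Y)`
    (Xs : ℕ → Ω → EuclideanSpace ℝ (Fin d)) (Ys : ℕ → Ω → ℝ)
    (hindep : iIndepFun (fun i ω => (Xs i ω, Ys i ω)) P)
    (hident : ∀ i, IdentDistrib (fun ω => (Xs i ω, Ys i ω)) (fun ω => (X ω, Y ω)) P P)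
    -- any maximum likelihood estimator: a maximizer whenever there is one
    (βhat : ℕ → Ω → EuclideanSpace ℝ (Fin d)) (shat : ℕ → Ω → ℝ)
    (hβhat : ∀ n, AEMeasurable (βhat n) P) (hshat : ∀ n, AEMeasurable (shat n) P)
    (hMLE : ∀ n, 1 ≤ n → ∀ᵐ ω ∂P,
      (∃ θ, IsMLE f (fun i => Xs i ω) (fun i => Ys i ω) n θ) →
        IsMLE f (fun i => Xs i ω) (fun i => Ys i ω) n (βhat n ω, shat n ω)) :
    TendstoInMeasure P (fun n ω => (βhat n ω, shat n ω)) atTop (fun _ => (β₀, s₀)) := by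
  have hXm : AEMeasurable X P := hA2.aemeasurable
  have hYm : AEMeasurable Y P := by
    refine AEMeasurable.congr (f := fun ω => inner ℝ β₀ (X ω) + ε ω) (by fun_prop) ?_
    filter_upwards [hY] with ω hω using hω.symm
  have hac : P.map ε ≪ volume := hA3' ▸ withDensity_absolutelyContinuous _ _
  have hnd : ∀ u : EuclideanSpace ℝ (Fin d) × ℝ, u ≠ 0 → ∀ᵐ ω ∂P, pairForm u (X ω, Y ω) ≠ 0 :=
    fun u hu => ae_pairForm_ne_zero hA2 hε hY hA1 hac hu
  have hpos : ∀ t, 0 < f t := hA3.pos_of_lintegral_lt_top hA7 hXm hYm (by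
    filter_upwards [hnd (0, 1) (by simp)] with ω hω
    simpa [pairForm] using hω) hA8
  have hint := integrable_unitLogLik hA3 hA7 hpos hXm hYm hA8
  obtain ⟨η, hη, hslab⟩ := exists_ae_eventually_slab_le hindep hident hXm hYm hnd
  have hball : ∀ r > 0, ∀ᵐ ω ∂P, ∀ᶠ n : ℕ in atTop,
      ∀ θ : EuclideanSpace ℝ (Fin d) × ℝ, 0 < θ.2 → r ≤ dist θ (β₀, s₀) →
      ∑ i ∈ Finset.range n, unitLogLik f θ (Xs i ω, Ys i ω)
        < ∑ i ∈ Finset.range n, unitLogLik f (β₀, s₀) (Xs i ω, Ys i ω) := fun r hr => by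
    refine ae_eventually_sum_unitLogLik_lt hA3.continuous.measurable hindep hident
      (hint (β₀, s₀) hs₀) (fun θ hs hne => ?_)
      (exists_ae_eventually_sum_lt_of_slab hA3 hA7 hpos hα hC hA4 hη hslab) hr
    obtain ⟨ρ, hρ, hρs, hρi, hlt⟩ := exists_integral_localMajorant_lt hA3 hA7 hpos hXm hYm hA8 θ hs
      (integral_unitLogLik_lt hA3 hA7 hpos (tendsto_zero_of_le_exp_neg_rpow hA3 hα hA4) hs₀ hA2 hε
        hY hA1 hA3' hs hne (hint θ hs) (hint (β₀, s₀) hs₀))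
    exact ⟨ρ, hρ, fun θ' hθ' => unitLogLik_le_localMajorant hA3 hA7 hpos hρs
      (Metric.mem_ball.1 hθ').le, hρi, hlt⟩
  refine tendstoInMeasure_of_tendsto_ae
    (fun n => ((hβhat n).prodMk (hshat n)).aestronglyMeasurable) ?_
  -- Countably many radii allow one exceptional null set. The cap `s₀ / 2` keeps the closed balls
  -- inside the region of positive scale.
  have hev : ∀ᵐ ω ∂P, ∀ k : ℕ, ∀ᶠ n : ℕ in atTop,
      dist (βhat n ω, shat n ω) (β₀, s₀) < min (s₀ / 2) (1 / ((k : ℝ) + 1)) := by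
    refine ae_all_iff.2 fun k => ?_
    have hr : 0 < min (s₀ / 2) (1 / ((k : ℝ) + 1)) := lt_min (by positivity) (by positivity)
    have hrs : min (s₀ / 2) (1 / ((k : ℝ) + 1)) < s₀ :=
      (min_le_left _ _).trans_lt (half_lt_self hs₀)
    filter_upwards [hball _ hr, ae_all_iff.2 fun n => (eventually_imp_distrib_left.2 (hMLE n))]
      with ω h1 h2
    filter_upwards [h1, eventually_ge_atTop 1] with n hn hn1
    obtain ⟨hex, hall⟩ := exists_isMLE_of_forall_lt hA3 hpos (fun i => Xs i ω) (fun i => Ys i ω) n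
      (θ₀ := (β₀, s₀)) hr hrs hn
    exact hall _ (h2 n hn1 hex)
  filter_upwards [hev] with ω hω
  refine Metric.tendsto_nhds.2 fun e he => ?_
  obtain ⟨k, hk⟩ := exists_nat_one_div_lt he
  filter_upwards [hω k] with n hn
  exact hn.trans ((min_le_right _ _).trans_lt hk)
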